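/- Let $N\ge 2$ be an integer, and let $X_0(N)$ be the modular curve, i.e. the compact Riemann surface obtained from the quotient $\Gamma_0(N)\backslash\mathbb{H}$ of the upper half-plane by adding the cusps. Let $\mathbb{C}(X_0(N))$ be its field of meromorphic functions, i.e. the field of meromorphic functions on $\mathbb{H}$ that are invariant under $\Gamma_0(N)$ and meromorphic at all cusps. Put $q=e^{2\pi i z}$, $E_4(z)=1+240\sum_{n\ge1}\sigma_3(n)q^n$, $\Delta(z)=q\prod_{n\ge1}(1-q^n)^{24}$ and $j=E_4^3/\Delta$. Then the functions $j(z)$ and $\Delta(Nz)/\Delta(z)$ belong to $\mathbb{C}(X_0(N))$ and generate it as a field over $\mathbb{C}$: $$\mathbb{C}(X_0(N))=\mathbb{C}\bigl(j,\ \Delta(N\cdot)/\Delta\bigr).$$ -/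

import Mathlib

open UpperHalfPlane Filter Topology MatrixGroups

namespace ModularCurve

/-- Complex-valued functions on `ℍ` representing meromorphic functions on the compact Riemann
surface `X₀(N)`: `f` is meromorphic on `ℍ`, invariant under `Γ₀(N)`, and meromorphic at every cusp.
The cusps are the points `γ ∞` with `γ ∈ SL₂(ℤ)`; meromorphy of `f` at `γ ∞` means that, for `Im z`
large, `f (γ z)` is a meromorphic function at `0` of the parameter `exp (2 π i z / N)`.
(The values of `f` at its poles carry no information: they are arbitrary complex numbers.) -/
structure IsModularFunction (N : ℕ) (f : ℍ → ℂ) : Prop where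
  meromorphic : ∀ z : ℍ, MeromorphicAt (fun w : ℂ ↦ f (ofComplex w)) (z : ℂ)
  invariant : ∀ γ ∈ CongruenceSubgroup.Gamma0 N, ∀ z : ℍ, f (γ • z) = f z
  cusps : ∀ γ : SL(2, ℤ), ∃ g : ℂ → ℂ, MeromorphicAt g 0 ∧
    ∀ᶠ z : ℍ in atImInfty, f (γ • z) = g (Function.Periodic.qParam (N : ℝ) (z : ℂ))

namespace IsModularFunction

variable {N : ℕ} {f g : ℍ → ℂ}

theorem const (N : ℕ) (c : ℂ) : IsModularFunction N (fun _ ↦ c) where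
  meromorphic _ := MeromorphicAt.const c _
  invariant _ _ _ := rfl
  cusps _ := ⟨fun _ ↦ c, MeromorphicAt.const c _, .of_forall fun _ ↦ rfl⟩

theorem add (hf : IsModularFunction N f) (hg : IsModularFunction N g) :
    IsModularFunction N (f + g) where
  meromorphic z := (hf.meromorphic z).add (hg.meromorphic z)
  invariant γ hγ z := by
    simp only [Pi.add_apply, hf.invariant γ hγ z, hg.invariant γ hγ z]
  cusps γ := by
    obtain ⟨F, hF, hF'⟩ := hf.cusps γ
    obtain ⟨G, hG, hG'⟩ := hg.cusps γ
    refine ⟨F + G, hF.add hG, ?_⟩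
    filter_upwards [hF', hG'] with z h1 h2
    simp only [Pi.add_apply, h1, h2]

theorem mul (hf : IsModularFunction N f) (hg : IsModularFunction N g) :
    IsModularFunction N (f * g) where
  meromorphic z := (hf.meromorphic z).mul (hg.meromorphic z)
  invariant γ hγ z := by
    simp only [Pi.mul_apply, hf.invariant γ hγ z, hg.invariant γ hγ z]
  cusps γ := by
    obtain ⟨F, hF, hF'⟩ := hf.cusps γ
    obtain ⟨G, hG, hG'⟩ := hg.cusps γ
    refine ⟨F * G, hF.mul hG, ?_⟩
    filter_upwards [hF', hG'] with z h1 h2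
    simp only [Pi.mul_apply, h1, h2]

theorem inv (hf : IsModularFunction N f) : IsModularFunction N f⁻¹ where
  meromorphic z := (hf.meromorphic z).inv
  invariant γ hγ z := by simp only [Pi.inv_apply, hf.invariant γ hγ z]
  cusps γ := by
    obtain ⟨F, hF, hF'⟩ := hf.cusps γ
    refine ⟨F⁻¹, hF.inv, ?_⟩
    filter_upwards [hF'] with z h1
    simp only [Pi.inv_apply, h1]

end IsModularFunction

/-- The `ℂ`-algebra of representatives of meromorphic functions on `X₀(N)`. -/
def modularFunctions (N : ℕ) : Subalgebra ℂ (ℍ → ℂ) where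
  carrier := {f | IsModularFunction N f}
  mul_mem' := IsModularFunction.mul
  add_mem' := IsModularFunction.add
  algebraMap_mem' c := IsModularFunction.const N c

/-- The representatives of the zero function: those which vanish outside a closed discrete subset
of `ℍ`. -/
def negligible (N : ℕ) : Ideal (modularFunctions N) where
  carrier := {f | (f : ℍ → ℂ) =ᶠ[codiscrete ℍ] 0}
  zero_mem' := by
    rw [Set.mem_ofPred_eq]
    exact EventuallyEq.rfl
  add_mem' {f g} hf hg := by
    rw [Set.mem_ofPred_eq] at hf hg ⊢
    filter_upwards [hf, hg] with z h1 h2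
    simp [h1, h2]
  smul_mem' c f hf := by
    rw [Set.mem_ofPred_eq] at hf ⊢
    filter_upwards [hf] with z h1
    simp [h1]

theorem mem_negligible_iff {N : ℕ} (f : modularFunctions N) :
    f ∈ negligible N ↔
      ∀ z : ℍ, ∀ᶠ w in 𝓝[≠] (z : ℂ), (f : ℍ → ℂ) (ofComplex w) = 0 := by
  change {z : ℍ | (f : ℍ → ℂ) z = 0} ∈ codiscreteWithin Set.univ ↔ _
  rw [mem_codiscreteWithin_iff_forall_mem_nhdsNE]
  simp only [Set.mem_univ, true_implies, Set.compl_univ, Set.union_empty]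
  refine forall_congr' fun z ↦ ?_
  have h : 𝓝[≠] (z : ℂ) = map ((↑) : ℍ → ℂ) (𝓝[≠] z) := by
    rw [← isOpenEmbedding_coe.map_nhdsWithin_preimage_eq]
    congr 2
    ext w
    simp [coe_inj]
  rw [h, eventually_map]
  simp [ofComplex_apply, Filter.Eventually]

/-- By the identity theorem, a nonzero meromorphic function on `X₀(N)` is invertible. -/
instance negligible_isMaximal (N : ℕ) : (negligible N).IsMaximal := by
  rw [Ideal.isMaximal_iff]
  constructor
  · intro h
    have := ((mem_negligible_iff _).1 h I).exists
    simp at this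
  · intro J f hJ hf hfJ
    have hm : MeromorphicOn (fun w : ℂ ↦ (f : ℍ → ℂ) (ofComplex w)) {w : ℂ | 0 < w.im} :=
      fun w hw ↦ f.2.meromorphic ⟨w, hw⟩
    have hconv : IsPreconnected {w : ℂ | 0 < w.im} :=
      (convex_halfSpace_im_gt 0).isPreconnected
    have hne : ∀ z : ℍ, ∀ᶠ w in 𝓝[≠] (z : ℂ), (f : ℍ → ℂ) (ofComplex w) ≠ 0 := by
      rw [mem_negligible_iff] at hf
      rw [not_forall] at hf
      obtain ⟨z₀, hz₀⟩ := hf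
      intro z
      rw [← meromorphicOrderAt_ne_top_iff_eventually_ne_zero (f.2.meromorphic z)]
      refine hm.meromorphicOrderAt_ne_top_of_isPreconnected hconv z₀.2 z.2 fun h ↦ ?_
      exact hz₀ (meromorphicOrderAt_eq_top_iff.1 h)
    let g : modularFunctions N := ⟨(f : ℍ → ℂ)⁻¹, IsModularFunction.inv f.2⟩
    have h1 : f * g - 1 ∈ negligible N := by
      rw [mem_negligible_iff]
      intro z
      filter_upwards [hne z] with w hw
      simp [g, hw]
    have h2 := J.sub_mem (J.mul_mem_right g hfJ) (hJ h1)
    simpa using h2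

/-- The function field `ℂ(X₀(N))` of meromorphic functions on `X₀(N)`. -/
abbrev X0FunctionField (N : ℕ) : Type := modularFunctions N ⧸ negligible N

noncomputable instance (N : ℕ) : Field (X0FunctionField N) :=
  Ideal.Quotient.field (negligible N)

/-- The element of `ℂ(X₀(N))` represented by a modular function. -/
def IsModularFunction.toField {N : ℕ} {f : ℍ → ℂ} (hf : IsModularFunction N f) :
    X0FunctionField N :=
  Ideal.Quotient.mk (negligible N) ⟨f, hf⟩

/-- The modular invariant `j = E₄³ / Δ`. -/
noncomputable def modularJ (z : ℍ) : ℂ :=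
  ModularForm.E₄ z ^ 3 / ModularForm.discriminant z

/-- The function `z ↦ Δ(N z) / Δ(z)`. -/
noncomputable def deltaQuotient (N : ℕ) (z : ℍ) : ℂ :=
  ModularForm.discriminant (ofComplex ((N : ℂ) * (z : ℂ))) / ModularForm.discriminant z

/-- For `N ≥ 1` the argument of `Δ` in the numerator of `deltaQuotient` is the point `N z`. -/
theorem coe_ofComplex_natCast_mul {N : ℕ} (hN : 0 < N) (z : ℍ) :
    ((ofComplex ((N : ℂ) * (z : ℂ)) : ℍ) : ℂ) = N * z := by
  have h : 0 < ((N : ℂ) * (z : ℂ)).im := by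
    simpa using mul_pos (Nat.cast_pos.2 hN) z.im_pos
  rw [ofComplex_apply_of_im_pos h]

end ModularCurve

/-!
Write `f(z) = Δ(Nz) / Δ(z)`. The proof is Lagrange interpolation over the finitely many right
cosets of `Γ₀(N)` in `SL₂(ℤ)`.

For a function `h` in `ℂ(X₀(N))` and a coset representative `γ`, put `h_γ(z) = h(γ z)`. The
polynomial `Q_h(X) = ∑_γ h_γ ∏_{δ ≠ γ} (X - f_δ)` does not change when `z` is replaced by `σ z` with
`σ ∈ SL₂(ℤ)`, since this only permutes the cosets (`map_compSmul_lagrangeNumerator`). Its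
coefficients are thus modular functions of level one, that is, rational functions of `j`
(`exists_polynomial_mul_eventuallyEq`). Substituting `X = f` leaves the term of the trivial coset:
`Q_h(f) = h · ∏_{δ ≠ 1} (f - f_δ)` (`eval_lagrangeNumerator`), and likewise
`Q_1(f) = ∏_{δ ≠ 1} (f - f_δ)`. If the latter is not zero, then `h = Q_h(f) / Q_1(f)` lies in
`ℂ(j, f)`.

That `f ≠ f_δ` for `δ ∉ Γ₀(N)` is read off at the cusp `∞`. Factoring
`diag(N, 1) δ = g (a, b; 0, d)` with `g ∈ SL₂(ℤ)` gives `f_δ(z) = d⁻¹² Δ((az + b) / d) / Δ(z)` with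
`ad = N`, and `a = N` happens only for `δ ∈ Γ₀(N)` (`exists_deltaQuotient_smul_eq`). If `a < N`, then
`Δ(Nz)` decays faster than `Δ((az + b) / d)` (`eventually_deltaQuotient_smul_ne`). The same formula
gives the invariance of `f` and its meromorphy at all cusps.

For level one, the poles of an invariant function in a fundamental domain are finite in number, and
multiplying by powers of `j - j(s)` cancels them
(`exists_polynomial_mul_meromorphicOrderAt_nonneg`). After removal of singularities, multiplying by
some `Δⁿ` yields a modular form of weight `12n`. By induction on `n`, subtracting a multiple of
`E₄³ⁿ` and dividing the resulting cusp form by `Δ`, every such form is `Δⁿ` times a polynomial in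
`j` (`exists_polynomial_eq_div_discriminant_pow`).
-/

open scoped ModularForm

namespace ModularCurve

/-! ### Holomorphic level one functions are polynomials in `j` -/

open Polynomial in
/-- Weight `12n` modular forms of level one are `Δⁿ` times polynomials in `j`: subtracting a
multiple of `E₄³ⁿ` gives a cusp form, which is divisible by `Δ`. -/
theorem exists_polynomial_eq_div_discriminant_pow (n : ℕ) (F : ModularForm 𝒮ℒ (12 * (n : ℤ))) :
    ∃ p : ℂ[X], ∀ z, F z / ModularForm.discriminant z ^ n = p.eval (modularJ z) := by
  induction n with
  | zero =>
    obtain ⟨c, hc⟩ := ModularFormClass.levelOne_weight_zero_const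
      (ModularForm.mcast (by simp) F : ModularForm 𝒮ℒ 0)
    refine ⟨C c, fun z ↦ ?_⟩
    simpa using congrFun hc z
  | succ n ih =>
    let E : ModularForm 𝒮ℒ (12 * ((n + 1 : ℕ) : ℤ)) :=
      (ModularForm.E₄.pow (3 * (n + 1))).mcast (by push_cast; ring)
    have hE : (qExpansion 1 E).coeff 0 = 1 := by
      have h4 : (qExpansion 1 ModularForm.E₄).coeff 0 = 1 :=
        EisensteinSeries.E_qExpansion_coeff_zero _ ⟨2, rfl⟩
      have : (E : ℍ → ℂ) = ModularForm.E₄.pow (3 * (n + 1)) := rfl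
      rw [this, ModularForm.qExpansion_pow one_pos one_mem_strictPeriods_SL,
        PowerSeries.coeff_zero_eq_constantCoeff, map_pow,
        ← PowerSeries.coeff_zero_eq_constantCoeff_apply, h4, one_pow]
    obtain ⟨g, hg⟩ := ModularForm.sub_smul_isCuspForm F E hE
    set c := (qExpansion 1 F).coeff 0
    obtain ⟨p, hp⟩ := ih ((CuspForm.discriminantEquiv g).mcast (by push_cast; ring))
    refine ⟨p + C c * X ^ (n + 1), fun z ↦ ?_⟩
    have hz := DFunLike.congr_fun hg z
    have hΔ := ModularForm.discriminant_ne_zero z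
    have hEz : E z = ModularForm.E₄ z ^ (3 * (n + 1)) := by
      exact congrFun (ModularForm.coe_pow ModularForm.E₄ (3 * (n + 1))) z
    have hFz : F z = g z + c * ModularForm.E₄ z ^ (3 * (n + 1)) := by
      rw [← hEz]
      change g z = F z - c * E z at hz
      rw [hz]; ring
    have hp := hp z
    change g z / _ / _ = _ at hp
    rw [eval_add, ← hp, hFz, modularJ]
    simp only [eval_mul, eval_C, eval_pow, eval_X, div_pow, ← pow_mul]
    field_simp
    ring

/-- An `SL₂(ℤ)`-invariant holomorphic function with at most a pole at infinity is a polynomial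
in `j`: multiplying by `Δⁿ` turns it into a modular form. -/
theorem exists_polynomial_eq_of_mdifferentiable {G : ℍ → ℂ}
    (hG : MDifferentiable (modelWithCornersSelf ℂ ℂ) (modelWithCornersSelf ℂ ℂ) G)
    (hinv : ∀ (γ : SL(2, ℤ)) (z : ℍ), G (γ • z) = G z) (n : ℕ)
    (hb : IsBoundedAtImInfty (fun z ↦ G z * ModularForm.discriminant z ^ n)) :
    ∃ p : Polynomial ℂ, ∀ z, G z = p.eval (modularJ z) := by
  let Dn : ModularForm 𝒮ℒ (12 * (n : ℤ)) :=
    ((ModularFormClass.modularForm CuspForm.discriminant).pow n).mcast (by ring)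
  have hDn : ∀ z, Dn z = ModularForm.discriminant z ^ n := fun z ↦ by
    exact congrFun (ModularForm.coe_pow (ModularFormClass.modularForm CuspForm.discriminant) n) z
  have hslash : ∀ γ : SL(2, ℤ), (fun z ↦ G z * Dn z) ∣[12 * (n : ℤ)] γ = fun z ↦ G z * Dn z := by
    intro γ
    ext z
    have h := congrFun (Dn.slash_action_eq' _ ⟨γ, rfl⟩) z
    change ((Dn : ℍ → ℂ) ∣[12 * (n : ℤ)] γ) z = Dn z at h
    rw [ModularForm.SL_slash_apply] at h ⊢
    rw [← h, hinv, mul_assoc]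
  let F : ModularForm 𝒮ℒ (12 * (n : ℤ)) :=
    { toFun z := G z * Dn z
      slash_action_eq' := by
        rintro _ ⟨γ, rfl⟩
        exact hslash γ
      holo' := hG.mul Dn.holo'
      bdd_at_cusps' := fun {c} hc ↦ by
        rw [Subgroup.IsArithmetic.isCusp_iff_isCusp_SL2Z] at hc
        rw [OnePoint.isBoundedAt_iff_forall_SL2Z hc]
        intro γ _
        rw [hslash γ]
        simpa only [hDn] using hb }
  obtain ⟨p, hp⟩ := exists_polynomial_eq_div_discriminant_pow n F
  refine ⟨p, fun z ↦ ?_⟩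
  rw [← hp z]
  change _ = G z * Dn z / _
  rw [hDn, mul_div_cancel_right₀ _ (pow_ne_zero _ (ModularForm.discriminant_ne_zero z))]

/-! ### The modular invariant as a modular function -/

theorem apply_smul_eq_denom_zpow_mul {F : Type*} [FunLike F ℍ ℂ] {k : ℤ}
    [SlashInvariantFormClass F 𝒮ℒ k] (f : F) (γ : SL(2, ℤ)) (z : ℍ) :
    f (γ • z) = denom γ z ^ k * f z := by
  have : SlashInvariantFormClass F (CongruenceSubgroup.Gamma 1) k :=
    CongruenceSubgroup.Gamma_one_coe_eq_SL ▸ ‹_›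
  exact SlashInvariantForm.slash_action_eqn_SL'' f (CongruenceSubgroup.mem_Gamma_one γ) z

theorem discriminant_smul (γ : SL(2, ℤ)) (z : ℍ) :
    ModularForm.discriminant (γ • z) = denom γ z ^ 12 * ModularForm.discriminant z := by
  exact_mod_cast apply_smul_eq_denom_zpow_mul CuspForm.discriminant γ z

theorem modularJ_smul (γ : SL(2, ℤ)) (z : ℍ) : modularJ (γ • z) = modularJ z := by
  have h : ModularForm.E₄ (γ • z) = denom γ z ^ 4 * ModularForm.E₄ z := by
    exact_mod_cast apply_smul_eq_denom_zpow_mul ModularForm.E₄ γ z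
  have hd : denom (γ : GL (Fin 2) ℝ) z ≠ 0 := denom_ne_zero _ z
  have hΔ := ModularForm.discriminant_ne_zero z
  rw [modularJ, modularJ, discriminant_smul, h]
  field_simp

theorem analyticAt_comp_ofComplex {f : ℍ → ℂ}
    (hf : MDifferentiable (modelWithCornersSelf ℂ ℂ) (modelWithCornersSelf ℂ ℂ) f) (z : ℍ) :
    AnalyticAt ℂ (fun w ↦ f (ofComplex w)) (z : ℂ) :=
  (UpperHalfPlane.mdifferentiable_iff.1 hf).analyticAt
    (isOpen_upperHalfPlaneSet.mem_nhds z.im_pos)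

theorem analyticAt_discriminant (z : ℍ) :
    AnalyticAt ℂ (fun w ↦ ModularForm.discriminant (ofComplex w)) (z : ℂ) :=
  analyticAt_comp_ofComplex CuspForm.discriminant.holo' z

theorem analyticAt_modularJ (z : ℍ) : AnalyticAt ℂ (fun w ↦ modularJ (ofComplex w)) (z : ℂ) :=
  ((analyticAt_comp_ofComplex ModularForm.E₄.holo' z).pow 3).div (analyticAt_discriminant z)
    (ModularForm.discriminant_ne_zero _)

theorem qParam_one_eq_pow {N : ℕ} (hN : N ≠ 0) (z : ℂ) :
    Function.Periodic.qParam 1 z = Function.Periodic.qParam N z ^ N := by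
  rw [Function.Periodic.qParam, Function.Periodic.qParam, ← Complex.exp_nat_mul]
  congr 1
  have : (N : ℂ) ≠ 0 := Nat.cast_ne_zero.2 hN
  push_cast
  field_simp

theorem analyticAt_cuspFunction_discriminant :
    AnalyticAt ℂ (cuspFunction 1 ModularForm.discriminant) 0 :=
  ModularFormClass.analyticAt_cuspFunction_zero CuspForm.discriminant one_pos
    one_mem_strictPeriods_SL

theorem cuspFunction_discriminant_qParam (z : ℍ) :
    cuspFunction 1 ModularForm.discriminant (Function.Periodic.qParam 1 z) =
      ModularForm.discriminant z :=
  SlashInvariantFormClass.eq_cuspFunction CuspForm.discriminant z one_mem_strictPeriods_SL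
    one_ne_zero

theorem isModularFunction_modularJ {N : ℕ} (hN : N ≠ 0) : IsModularFunction N modularJ where
  meromorphic z := (analyticAt_modularJ z).meromorphicAt
  invariant γ _ z := modularJ_smul γ z
  cusps γ := by
    have hE : AnalyticAt ℂ (cuspFunction 1 ModularForm.E₄) 0 :=
      ModularFormClass.analyticAt_cuspFunction_zero ModularForm.E₄ one_pos
        one_mem_strictPeriods_SL
    have hp : AnalyticAt ℂ (fun x : ℂ ↦ x ^ N) 0 := by fun_prop
    have h0 : (0 : ℂ) ^ N = 0 := zero_pow hN
    have h1 : AnalyticAt ℂ (fun x : ℂ ↦ cuspFunction 1 ModularForm.E₄ (x ^ N)) 0 :=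
      AnalyticAt.fun_comp (g := cuspFunction 1 ModularForm.E₄) (by rwa [h0]) hp
    have h2 : AnalyticAt ℂ (fun x : ℂ ↦ cuspFunction 1 ModularForm.discriminant (x ^ N)) 0 :=
      AnalyticAt.fun_comp (g := cuspFunction 1 ModularForm.discriminant)
        (by rw [h0]; exact analyticAt_cuspFunction_discriminant) hp
    refine ⟨fun x ↦ cuspFunction 1 ModularForm.E₄ (x ^ N) ^ 3 /
      cuspFunction 1 ModularForm.discriminant (x ^ N),
      (h1.meromorphicAt.pow 3).div h2.meromorphicAt, .of_forall fun z ↦ ?_⟩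
    beta_reduce
    rw [modularJ_smul, ← qParam_one_eq_pow hN, cuspFunction_discriminant_qParam,
      SlashInvariantFormClass.eq_cuspFunction ModularForm.E₄ z one_mem_strictPeriods_SL
        one_ne_zero, modularJ]

theorem tendsto_norm_modularJ_atImInfty : Tendsto (fun z ↦ ‖modularJ z‖) atImInfty atTop := by
  have hE : Tendsto ModularForm.E₄ atImInfty (𝓝 1) := by
    have h0 := ModularFormClass.analyticAt_cuspFunction_zero ModularForm.E₄ one_pos
      one_mem_strictPeriods_SL
    have h1 : cuspFunction 1 ModularForm.E₄ 0 = 1 := by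
      have := EisensteinSeries.E_qExpansion_coeff_zero (k := 4) (by norm_num) ⟨2, rfl⟩
      simpa [qExpansion_coeff] using this
    have h2 := h0.continuousAt.tendsto.comp (qParam_tendsto_atImInfty one_pos)
    rw [h1] at h2
    exact h2.congr fun z ↦ SlashInvariantFormClass.eq_cuspFunction ModularForm.E₄ z
      one_mem_strictPeriods_SL one_ne_zero
  have hΔ : Tendsto (fun z ↦ ‖ModularForm.discriminant z‖) atImInfty (𝓝[>] 0) := by
    refine tendsto_nhdsWithin_iff.2 ⟨?_, .of_forall fun z ↦
      norm_pos_iff.2 (ModularForm.discriminant_ne_zero z)⟩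
    have h : Tendsto ModularForm.discriminant atImInfty (𝓝 0) :=
      ModularForm.discriminant_isZeroAtImInfty
    simpa using h.norm
  have h := (hE.pow 3).norm.pos_mul_atTop (by simp) (tendsto_inv_nhdsGT_zero.comp hΔ)
  refine h.congr fun z ↦ ?_
  simp [modularJ, div_eq_mul_inv]

/-! ### Level one modular functions are rational functions of `j` -/

theorem discriminant_isBigO_exp :
    ModularForm.discriminant =O[atImInfty] fun τ ↦ Real.exp (-2 * Real.pi * τ.im) := by
  simpa using CuspFormClass.exp_decay_atImInfty (h := 1) CuspForm.discriminant one_pos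
    one_mem_strictPeriods_SL

theorem tendsto_qParam_atImInfty_nhdsNE {N : ℕ} (hN : 0 < N) :
    Tendsto (fun z : ℍ ↦ Function.Periodic.qParam N z) atImInfty (𝓝[≠] 0) :=
  (Function.Periodic.qParam_tendsto (Nat.cast_pos.2 hN)).comp tendsto_coe_atImInfty

/-- A function which is meromorphic at the cusp `∞` has no poles high up in `ℍ`. -/
theorem exists_forall_analyticAt_of_meromorphicAt_cusp {N : ℕ} (hN : 0 < N) {f : ℍ → ℂ}
    {g : ℂ → ℂ} (hg : MeromorphicAt g 0)
    (hfg : ∀ᶠ z : ℍ in atImInfty, f z = g (Function.Periodic.qParam (N : ℝ) (z : ℂ))) :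
    ∃ A : ℝ, ∀ z : ℍ, A < z.im → AnalyticAt ℂ (fun w ↦ f (ofComplex w)) (z : ℂ) := by
  have h := hfg.and ((tendsto_qParam_atImInfty_nhdsNE hN).eventually hg.eventually_analyticAt)
  obtain ⟨A, hA⟩ := (atImInfty_mem _).1 h
  refine ⟨A, fun z hz ↦ ?_⟩
  have hq : AnalyticAt ℂ (Function.Periodic.qParam (N : ℝ)) (z : ℂ) :=
    Function.Periodic.differentiable_qParam.analyticAt _
  refine (AnalyticAt.fun_comp (hA z hz.le).2 hq).congr ?_
  have h1 : ∀ᶠ w : ℂ in 𝓝 (z : ℂ), A < w.im ∧ 0 < w.im :=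
    ((isOpen_lt continuous_const Complex.continuous_im).inter
      (isOpen_lt continuous_const Complex.continuous_im)).mem_nhds ⟨hz, z.im_pos⟩
  filter_upwards [h1] with w hw
  have := (hA ⟨w, hw.2⟩ hw.1.le).1
  rw [ofComplex_apply_of_im_pos hw.2]
  exact this.symm

/-- A function which is meromorphic at the cusp `∞` has a pole of finite order there, so that
a power of `Δ` cancels it. -/
theorem exists_isBoundedAtImInfty_mul_discriminant_pow {N : ℕ} (hN : 0 < N) {f : ℍ → ℂ}
    {g : ℂ → ℂ} (hg : MeromorphicAt g 0)
    (hfg : ∀ᶠ z : ℍ in atImInfty, f z = g (Function.Periodic.qParam (N : ℝ) (z : ℂ))) :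
    ∃ n : ℕ, IsBoundedAtImInfty (fun z ↦ f z * ModularForm.discriminant z ^ n) := by
  obtain ⟨n, hn⟩ := hg
  refine ⟨n, ?_⟩
  have h1 : (fun z : ℍ ↦ Function.Periodic.qParam N z ^ n *
      g (Function.Periodic.qParam N z)) =O[atImInfty] (1 : ℍ → ℝ) := by
    have h := (hn.continuousAt.tendsto.isBigO_one ℝ).comp_tendsto
      (qParam_tendsto_atImInfty (Nat.cast_pos.2 hN))
    simp only [Function.comp_def, sub_zero, smul_eq_mul] at h
    exact h
  have h2 : ModularForm.discriminant =O[atImInfty]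
      fun z : ℍ ↦ Function.Periodic.qParam N z := by
    refine discriminant_isBigO_exp.trans (Asymptotics.isBigO_of_le _ fun z ↦ ?_)
    rw [Function.Periodic.norm_qParam, Real.norm_of_nonneg (Real.exp_nonneg _)]
    refine Real.exp_le_exp.2 ?_
    have hN' : (1 : ℝ) ≤ N := by exact_mod_cast hN
    rw [le_div_iff₀ (by positivity)]
    have : 0 < 2 * Real.pi * z.im := by have := z.im_pos; positivity
    change _ ≤ -2 * Real.pi * z.im
    nlinarith
  have h3 : (fun z ↦ f z * ModularForm.discriminant z ^ n) =O[atImInfty]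
      fun z : ℍ ↦ Function.Periodic.qParam N z ^ n * g (Function.Periodic.qParam N z) := by
    have := (Filter.EventuallyEq.isBigO hfg).mul (h2.pow n)
    simpa only [mul_comm] using this
  exact h3.trans h1

/-- A pole is cancelled by a power of any analytic function vanishing there. -/
theorem exists_meromorphicOrderAt_pow_mul_nonneg {f g : ℂ → ℂ} {x : ℂ} (hf : MeromorphicAt f x)
    (hg : AnalyticAt ℂ g x) (hgx : g x = 0) :
    ∃ m : ℕ, 0 ≤ meromorphicOrderAt (fun w ↦ g w ^ m * f w) x := by
  obtain ⟨m, hm⟩ := hf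
  obtain ⟨k, hk, hgk⟩ : ∃ k : ℂ → ℂ, AnalyticAt ℂ k x ∧ ∀ᶠ w in 𝓝 x, g w = (w - x) * k w := by
    have h1 : 1 ≤ analyticOrderAt g x :=
      Order.one_le_iff_ne_zero.2 fun h ↦ (analyticOrderAt_eq_zero.1 h).elim (· hg) (· hgx)
    obtain ⟨k, hk, h⟩ := (natCast_le_analyticOrderAt hg (n := 1)).1 (by exact_mod_cast h1)
    exact ⟨k, hk, by simpa using h⟩
  refine ⟨m, ?_⟩
  have h : (fun w ↦ g w ^ m * f w) =ᶠ[𝓝 x] fun w ↦ k w ^ m * ((w - x) ^ m • f w) := by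
    filter_upwards [hgk] with w hw
    rw [hw, mul_pow, smul_eq_mul]
    ring
  rw [meromorphicOrderAt_congr (h.filter_mono nhdsWithin_le_nhds)]
  exact ((hk.pow m).mul hm).meromorphicOrderAt_nonneg

theorem meromorphicOrderAt_mul_nonneg {f g : ℂ → ℂ} {x : ℂ} (hf : MeromorphicAt f x)
    (hg : AnalyticAt ℂ g x) (h : 0 ≤ meromorphicOrderAt f x) :
    0 ≤ meromorphicOrderAt (fun w ↦ g w * f w) x := by
  rw [fun_meromorphicOrderAt_mul hg.meromorphicAt hf]
  exact add_nonneg hg.meromorphicOrderAt_nonneg h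

theorem analyticAt_eval_modularJ (p : Polynomial ℂ) (z : ℍ) :
    AnalyticAt ℂ (fun w ↦ p.eval (modularJ (ofComplex w))) (z : ℂ) := by
  simpa [Polynomial.aeval_def] using (analyticAt_modularJ z).aeval_polynomial p

theorem meromorphicOrderAt_smul_of_invariant {h : ℍ → ℂ}
    (hinv : ∀ (γ : SL(2, ℤ)) (z : ℍ), h (γ • z) = h z) (γ : SL(2, ℤ)) (z : ℍ) :
    meromorphicOrderAt (fun w ↦ h (ofComplex w)) ((γ • z : ℍ) : ℂ) =
      meromorphicOrderAt (fun w ↦ h (ofComplex w)) (z : ℂ) := by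
  have hdet : 0 < (Matrix.SpecialLinearGroup.mapGL ℝ γ).det.val := by simp
  have H := meromorphicOrderAt_comp_smul (f := h) (τ := z) hdet
  refine H.symm.trans ?_
  congr 1
  ext w
  exact hinv γ _

/-- The poles of an `SL₂(ℤ)`-invariant meromorphic function on `ℍ` without poles high up can be
cancelled by a polynomial in `j`: it suffices to treat the poles in a truncated fundamental domain,
which are finite in number because it is compact. -/
theorem exists_polynomial_mul_meromorphicOrderAt_nonneg {f : ℍ → ℂ} {A : ℝ}
    (hf : ∀ z : ℍ, MeromorphicAt (fun w : ℂ ↦ f (ofComplex w)) (z : ℂ))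
    (hinv : ∀ (γ : SL(2, ℤ)) (z : ℍ), f (γ • z) = f z)
    (hA : ∀ z : ℍ, A < z.im → AnalyticAt ℂ (fun w ↦ f (ofComplex w)) (z : ℂ)) :
    ∃ r : Polynomial ℂ, r ≠ 0 ∧ ∀ z : ℍ,
      0 ≤ meromorphicOrderAt (fun w ↦ r.eval (modularJ (ofComplex w)) * f (ofComplex w)) z := by
  classical
  -- `S` is the set of poles in the truncated fundamental domain
  set K := UpperHalfPlane.coe '' ModularGroup.truncatedFundamentalDomain A
  have hK : IsCompact K :=
    (ModularGroup.isCompact_truncatedFundamentalDomain A).image continuous_coe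
  have hfK : MeromorphicOn (fun w : ℂ ↦ f (ofComplex w)) K := by
    rintro _ ⟨z, -, rfl⟩
    exact hf z
  have hfin := hK.finite_sdiff_of_mem_codiscreteWithin hfK.analyticAt_mem_codiscreteWithin
  set S := hfin.toFinset
  have hpole : ∀ s : ℂ, ∃ m : ℕ, s ∈ S → 0 ≤ meromorphicOrderAt (fun w ↦
      (modularJ (ofComplex w) - modularJ (ofComplex s)) ^ m * f (ofComplex w)) s := by
    intro s
    by_cases hs : s ∈ S
    · obtain ⟨z, -, rfl⟩ := ((Set.Finite.mem_toFinset hfin).1 hs).1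
      obtain ⟨m, hm⟩ := exists_meromorphicOrderAt_pow_mul_nonneg (hf z)
        ((analyticAt_modularJ z).sub (analyticAt_const (v := modularJ (ofComplex z)))) (sub_self _)
      exact ⟨m, fun _ ↦ hm⟩
    · exact ⟨0, fun h ↦ absurd h hs⟩
  choose m hm using hpole
  let r : Polynomial ℂ :=
    ∏ s ∈ S, (Polynomial.X - Polynomial.C (modularJ (ofComplex s))) ^ m s
  refine ⟨r, Finset.prod_ne_zero_iff.2 fun s _ ↦ pow_ne_zero _ (Polynomial.X_sub_C_ne_zero _),
    fun z ↦ ?_⟩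
  obtain ⟨γ, hγ⟩ := ModularGroup.exists_smul_mem_fd z
  -- by invariance it suffices to look at a point of the fundamental domain
  have horder := meromorphicOrderAt_smul_of_invariant
    (h := fun z ↦ r.eval (modularJ z) * f z) (fun γ z ↦ by rw [hinv, modularJ_smul]) γ z
  rw [← horder]
  set y : ℍ := γ • z
  by_cases hy : AnalyticAt ℂ (fun w ↦ f (ofComplex w)) (y : ℂ)
  · exact ((analyticAt_eval_modularJ r y).mul hy).meromorphicOrderAt_nonneg
  have hyS : (y : ℂ) ∈ S :=
    (Set.Finite.mem_toFinset hfin).2 ⟨⟨y, ⟨hγ, not_lt.1 fun h ↦ hy (hA y h)⟩, rfl⟩, hy⟩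
  let r' : Polynomial ℂ :=
    ∏ s ∈ S.erase y, (Polynomial.X - Polynomial.C (modularJ (ofComplex s))) ^ m s
  have hr : (fun w ↦ r.eval (modularJ (ofComplex w)) * f (ofComplex w)) = fun w ↦
      r'.eval (modularJ (ofComplex w)) *
        ((modularJ (ofComplex w) - modularJ (ofComplex y)) ^ m y * f (ofComplex w)) := by
    ext w
    have : r = (Polynomial.X - Polynomial.C (modularJ (ofComplex (y : ℂ)))) ^ m y * r' :=
      (Finset.mul_prod_erase S _ hyS).symm
    rw [this]
    simp
    ring
  rw [hr]
  refine meromorphicOrderAt_mul_nonneg ?_ (analyticAt_eval_modularJ r' y) (hm y hyS)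
  exact (((analyticAt_modularJ y).sub analyticAt_const).pow _).meromorphicAt.mul (hf y)

theorem nhdsNE_coe_eq_map (z : ℍ) : 𝓝[≠] (z : ℂ) = map ((↑) : ℍ → ℂ) (𝓝[≠] z) := by
  rw [← isOpenEmbedding_coe.map_nhdsWithin_preimage_eq]
  congr 2
  ext w
  simp [coe_inj]

theorem eventually_nhdsNE_coe_iff {z : ℍ} {P : ℍ → Prop} :
    (∀ᶠ w in 𝓝[≠] (z : ℂ), P (ofComplex w)) ↔ ∀ᶠ w in 𝓝[≠] z, P w := by
  simp [nhdsNE_coe_eq_map]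

instance nhdsNE_neBot (z : ℍ) : (𝓝[≠] z).NeBot :=
  map_neBot_iff ((↑) : ℍ → ℂ) |>.1 (nhdsNE_coe_eq_map z ▸ inferInstance)

theorem tendsto_smul_nhdsNE (γ : SL(2, ℤ)) (z : ℍ) :
    Tendsto (fun w : ℍ ↦ γ • w) (𝓝[≠] z) (𝓝[≠] (γ • z)) := by
  have hc : Continuous fun w : ℍ ↦ γ • w :=
    continuous_const_smul (Matrix.SpecialLinearGroup.mapGL ℝ γ)
  exact hc.continuousAt.tendsto.inf
    (tendsto_principal_principal.2 fun w hw ↦ (MulAction.injective γ).ne hw)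

/-- Removing the removable singularities of an invariant function on `ℍ`. -/
theorem exists_mdifferentiable_eventuallyEq {H : ℍ → ℂ}
    (hm : ∀ z : ℍ, MeromorphicAt (fun w : ℂ ↦ H (ofComplex w)) (z : ℂ))
    (ho : ∀ z : ℍ, 0 ≤ meromorphicOrderAt (fun w : ℂ ↦ H (ofComplex w)) (z : ℂ))
    (hinv : ∀ (γ : SL(2, ℤ)) (z : ℍ), H (γ • z) = H z) :
    ∃ G : ℍ → ℂ,
      MDifferentiable (modelWithCornersSelf ℂ ℂ) (modelWithCornersSelf ℂ ℂ) G ∧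
      (∀ (γ : SL(2, ℤ)) (z : ℍ), G (γ • z) = G z) ∧ ∀ z : ℍ, G =ᶠ[𝓝[≠] z] H := by
  -- the normal form of a meromorphic function of nonnegative order is analytic
  let U : Set ℂ := {w | 0 < w.im}
  have hmU : MeromorphicOn (fun w : ℂ ↦ H (ofComplex w)) U := fun w hw ↦ hm ⟨w, hw⟩
  set F := toMeromorphicNFOn (fun w : ℂ ↦ H (ofComplex w)) U
  have hF : ∀ z : ℍ, AnalyticAt ℂ F (z : ℂ) := fun z ↦ by
    refine ((meromorphicNFOn_toMeromorphicNFOn _ U) z.2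
      ).meromorphicOrderAt_nonneg_iff_analyticAt.1 ?_
    rw [meromorphicOrderAt_toMeromorphicNFOn hmU z.2]
    exact ho z
  let G : ℍ → ℂ := fun z ↦ F z
  have hGH : ∀ z : ℍ, G =ᶠ[𝓝[≠] z] H := fun z ↦ by
    have h := hmU.toMeromorphicNFOn_eq_self_on_nhdsNE z.2
    rw [nhdsNE_coe_eq_map, EventuallyEq, eventually_map] at h
    filter_upwards [h] with w hw
    simpa using hw
  have hG : MDifferentiable (modelWithCornersSelf ℂ ℂ) (modelWithCornersSelf ℂ ℂ) G := by
    rw [UpperHalfPlane.mdifferentiable_iff]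
    refine DifferentiableOn.congr
      (fun w hw ↦ (hF ⟨w, hw⟩).differentiableAt.differentiableWithinAt) fun w hw ↦ ?_
    simp [G, ofComplex_apply_of_im_pos (Set.mem_ofPred.1 hw)]
  refine ⟨G, hG, fun γ z ↦ ?_, hGH⟩
  -- the invariance of `H` off a discrete set passes to `G` by continuity
  have h1 : Tendsto G (𝓝[≠] z) (𝓝 (G z)) :=
    hG.continuous.continuousAt.tendsto.mono_left nhdsWithin_le_nhds
  have h2 : Tendsto (fun w ↦ G (γ • w)) (𝓝[≠] z) (𝓝 (G (γ • z))) :=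
    (hG.continuous.continuousAt.tendsto.mono_left nhdsWithin_le_nhds).comp
      (tendsto_smul_nhdsNE γ z)
  refine tendsto_nhds_unique_of_eventuallyEq h2 h1 ?_
  filter_upwards [hGH z, (tendsto_smul_nhdsNE γ z).eventually (hGH (γ • z))] with w hw hw'
  rw [hw, hw', hinv]

theorem IsModularFunction.eval_modularJ {N : ℕ} (hN : N ≠ 0) (p : Polynomial ℂ) :
    IsModularFunction N (fun z ↦ p.eval (modularJ z)) := by
  induction p using Polynomial.induction_on' with
  | add p q hp hq => simpa only [Polynomial.eval_add] using! hp.add hq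
  | monomial n a =>
    have h : ∀ n : ℕ, IsModularFunction N (modularJ ^ n) := fun n ↦ by
      induction n with
      | zero => exact .const N 1
      | succ n ih => rw [pow_succ]; exact ih.mul (isModularFunction_modularJ hN)
    simpa only [Polynomial.eval_monomial] using! (IsModularFunction.const N a).mul (h n)

/-- An `SL₂(ℤ)`-invariant modular function is a rational function of `j`. -/
theorem exists_polynomial_mul_eventuallyEq {N : ℕ} (hN : N ≠ 0) {f : ℍ → ℂ}
    (hf : IsModularFunction N f) (hinv : ∀ (γ : SL(2, ℤ)) (z : ℍ), f (γ • z) = f z) :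
    ∃ p r : Polynomial ℂ, r ≠ 0 ∧
      ∀ z : ℍ, ∀ᶠ w in 𝓝[≠] z, r.eval (modularJ w) * f w = p.eval (modularJ w) := by
  have hN0 : 0 < N := Nat.pos_of_ne_zero hN
  obtain ⟨g, hg, hfg⟩ := hf.cusps 1
  simp only [one_smul] at hfg
  obtain ⟨A, hA⟩ := exists_forall_analyticAt_of_meromorphicAt_cusp hN0 hg hfg
  obtain ⟨r, hr, hord⟩ := exists_polynomial_mul_meromorphicOrderAt_nonneg hf.meromorphic hinv hA
  have hH : IsModularFunction N (fun z ↦ r.eval (modularJ z) * f z) :=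
    (IsModularFunction.eval_modularJ hN r).mul hf
  obtain ⟨G, hG, hGinv, hGH⟩ := exists_mdifferentiable_eventuallyEq
    (H := fun z ↦ r.eval (modularJ z) * f z) hH.meromorphic hord fun γ z ↦ by rw [hinv, modularJ_smul]
  obtain ⟨g', hg', hHg⟩ := hH.cusps 1
  simp only [one_smul] at hHg
  obtain ⟨n, hn⟩ := exists_isBoundedAtImInfty_mul_discriminant_pow hN0 hg' hHg
  obtain ⟨M, B, hMB⟩ := isBoundedAtImInfty_iff.1 hn
  have hb : IsBoundedAtImInfty (fun z ↦ G z * ModularForm.discriminant z ^ n) := by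
    refine isBoundedAtImInfty_iff.2 ⟨M, B + 1, fun z hz ↦ ?_⟩
    have hc : Continuous fun z ↦ G z * ModularForm.discriminant z ^ n :=
      hG.continuous.mul (CuspForm.discriminant.holo'.continuous.pow n)
    refine le_of_tendsto (hc.norm.continuousAt.tendsto.mono_left
      (nhdsWithin_le_nhds (s := {z}ᶜ))) ?_
    have h1 : ∀ᶠ w : ℍ in 𝓝[≠] z, B < w.im := nhdsWithin_le_nhds
      ((isOpen_lt continuous_const continuous_im).mem_nhds (by simpa using by linarith))
    filter_upwards [hGH z, h1] with w hw hw'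
    rw [hw]
    exact hMB w hw'.le
  obtain ⟨p, hp⟩ := exists_polynomial_eq_of_mdifferentiable hG hGinv n hb
  refine ⟨p, r, hr, fun z ↦ ?_⟩
  filter_upwards [hGH z] with w hw
  rw [← hp w, hw]

/-! ### The conjugates of `Δ(Nz) / Δ(z)` -/

/-- Every integral matrix of positive determinant is the product of an element of `SL₂(ℤ)` and an
upper triangular matrix with positive diagonal entries. -/
theorem exists_eq_mul_upperTriangular {m : ℤ} (hm : 0 < m) (A : FixedDetMatrix (Fin 2) ℤ m) :
    ∃ (g : SL(2, ℤ)) (a d : ℕ) (b : ℤ), 0 < a ∧ 0 < d ∧ (a * d : ℤ) = m ∧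
      A.1 = g.1 * !![(a : ℤ), b; 0, (d : ℤ)] := by
  induction A using FixedDetMatrices.induction_on hm.ne' with
  | h0 A h10 h00 _ _ =>
    have hdet : A.1 0 0 * A.1 1 1 = m := by
      simpa [Matrix.det_fin_two, h10] using A.2
    have h11 : 0 < A.1 1 1 := pos_of_mul_pos_right (by rwa [hdet]) h00.le
    refine ⟨1, (A.1 0 0).toNat, (A.1 1 1).toNat, A.1 0 1, by lia, by lia, ?_, ?_⟩
    · rw [Int.toNat_of_nonneg h00.le, Int.toNat_of_nonneg h11.le, hdet]
    · rw [Int.toNat_of_nonneg h00.le, Int.toNat_of_nonneg h11.le, Matrix.SpecialLinearGroup.coe_one,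
        one_mul, ← h10]
      exact Matrix.eta_fin_two A.1
  | hS A h =>
    obtain ⟨g, a, d, b, ha, hd, had, h⟩ := h
    refine ⟨ModularGroup.S * g, a, d, b, ha, hd, had, ?_⟩
    rw [FixedDetMatrices.smul_coe, h, Matrix.SpecialLinearGroup.coe_mul, mul_assoc]
  | hT A h =>
    obtain ⟨g, a, d, b, ha, hd, had, h⟩ := h
    refine ⟨ModularGroup.T * g, a, d, b, ha, hd, had, ?_⟩
    rw [FixedDetMatrices.smul_coe, h, Matrix.SpecialLinearGroup.coe_mul, mul_assoc]

theorem im_affine_pos {a d : ℕ} (b : ℤ) (ha : 0 < a) (hd : 0 < d) (z : ℍ) :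
    0 < (((a : ℂ) * z + b) / d).im := by
  have : (((a : ℂ) * z + b) / d).im = a * z.im / d := by
    rw [Complex.div_natCast_im]
    simp
  rw [this]
  have := z.im_pos
  positivity

/-- The `SL₂(ℤ)`-conjugates of `Δ(Nz) / Δ(z)` are the functions `d⁻¹² Δ((az + b) / d) / Δ(z)` with
`ad = N`, and `a = N` occurs only for `Γ₀(N)`: this comes from factoring
`diag(N, 1) γ = g (a, b; 0, d)` with `g ∈ SL₂(ℤ)`. -/
theorem exists_deltaQuotient_smul_eq {N : ℕ} (hN : N ≠ 0) (γ : SL(2, ℤ)) :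
    ∃ (a d : ℕ) (b : ℤ), 0 < a ∧ 0 < d ∧ a * d = N ∧
      (a = N ↔ γ ∈ CongruenceSubgroup.Gamma0 N) ∧
      ∀ z : ℍ, deltaQuotient N (γ • z) =
        ModularForm.discriminant (ofComplex (((a : ℂ) * z + b) / d)) /
          ((d : ℂ) ^ 12 * ModularForm.discriminant z) := by
  let A : FixedDetMatrix (Fin 2) ℤ (N : ℤ) :=
    ⟨!![(N : ℤ) * γ 0 0, N * γ 0 1; γ 1 0, γ 1 1], by
      have := γ.det_coe
      rw [Matrix.det_fin_two] at this
      rw [Matrix.det_fin_two_of]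
      linear_combination (N : ℤ) * this⟩
  obtain ⟨g, a, d, b, ha, hd, had, hA⟩ := exists_eq_mul_upperTriangular (by lia) A
  have e00 : (N : ℤ) * γ 0 0 = g 0 0 * a := by
    simpa [A, Matrix.mul_apply, Fin.sum_univ_two] using congrFun (congrFun hA 0) 0
  have e01 : (N : ℤ) * γ 0 1 = g 0 0 * b + g 0 1 * d := by
    simpa [A, Matrix.mul_apply, Fin.sum_univ_two] using congrFun (congrFun hA 0) 1
  have e10 : γ 1 0 = g 1 0 * a := by
    simpa [A, Matrix.mul_apply, Fin.sum_univ_two] using congrFun (congrFun hA 1) 0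
  have e11 : γ 1 1 = g 1 0 * b + g 1 1 * d := by
    simpa [A, Matrix.mul_apply, Fin.sum_univ_two] using congrFun (congrFun hA 1) 1
  have had' : a * d = N := by exact_mod_cast had
  refine ⟨a, d, b, ha, hd, had', ?_, fun z ↦ ?_⟩
  · rw [CongruenceSubgroup.Gamma0_mem, ZMod.intCast_zmod_eq_zero_iff_dvd]
    constructor
    · rintro rfl
      exact e10 ▸ dvd_mul_left _ _
    · -- the first column of `g` is coprime, so that `N ∣ a`
      intro h
      have hg := g.det_coe
      rw [Matrix.det_fin_two] at hg
      have h1 : (N : ℤ) ∣ a := by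
        have : (a : ℤ) = g 1 1 * (N * γ 0 0) - g 0 1 * γ 1 0 := by
          rw [e00, e10]
          linear_combination -(a : ℤ) * hg
        rw [this]
        exact dvd_sub ((dvd_mul_right _ _).mul_left _) (h.mul_left _)
      exact Nat.dvd_antisymm (had' ▸ dvd_mul_right a d) (Int.natCast_dvd_natCast.1 h1)
  · have hd0 : (d : ℂ) ≠ 0 := Nat.cast_ne_zero.2 hd.ne'
    set w : ℍ := ofComplex (((a : ℂ) * z + b) / d) with hw
    have hwc : (w : ℂ) = ((a : ℂ) * z + b) / d := by
      rw [hw, ofComplex_apply_of_im_pos (im_affine_pos b ha hd z)]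
    have c00 : (N : ℂ) * γ 0 0 = g 0 0 * a := by exact_mod_cast e00
    have c01 : (N : ℂ) * γ 0 1 = g 0 0 * b + g 0 1 * d := by exact_mod_cast e01
    have c10 : (γ 1 0 : ℂ) = g 1 0 * a := by exact_mod_cast e10
    have c11 : (γ 1 1 : ℂ) = g 1 0 * b + g 1 1 * d := by exact_mod_cast e11
    have hden : denom (γ : GL (Fin 2) ℝ) z = d * denom (g : GL (Fin 2) ℝ) w := by
      rw [ModularGroup.denom_apply, ModularGroup.denom_apply, hwc, c10, c11]
      field_simp
      ring
    have hγ := denom_ne_zero (γ : GL (Fin 2) ℝ) z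
    have hg := denom_ne_zero (g : GL (Fin 2) ℝ) w
    have hpt : ofComplex ((N : ℂ) * ((γ • z : ℍ) : ℂ)) = g • w := by
      ext
      rw [coe_ofComplex_natCast_mul (Nat.pos_of_ne_zero hN), coe_specialLinearGroup_apply,
        coe_specialLinearGroup_apply]
      have hnum : (N : ℂ) * (γ 0 0 * z + γ 0 1) = d * (g 0 0 * w + g 0 1) := by
        rw [hwc]
        field_simp
        linear_combination (z : ℂ) * c00 + c01
      rw [ModularGroup.denom_apply, ModularGroup.denom_apply] at hden
      simp only [algebraMap_int_eq, eq_intCast, Complex.ofReal_intCast]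
      rw [← mul_div_assoc, hnum, hden, mul_div_mul_left _ _ hd0]
    have hΔ := ModularForm.discriminant_ne_zero z
    rw [deltaQuotient, hpt, discriminant_smul, discriminant_smul, hden]
    rw [hden] at hγ
    field_simp

theorem qParam_one_affine {N a d : ℕ} (b : ℤ) (hd : 0 < d) (ha : 0 < a) (had : a * d = N) (z : ℂ) :
    Function.Periodic.qParam 1 (((a : ℂ) * z + b) / d) =
      Complex.exp (2 * Real.pi * Complex.I * (b / d)) *
        Function.Periodic.qParam N z ^ (a * a) := by
  rw [Function.Periodic.qParam, Function.Periodic.qParam, ← Complex.exp_nat_mul, ← Complex.exp_add]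
  congr 1
  have h1 : (a : ℂ) ≠ 0 := Nat.cast_ne_zero.2 ha.ne'
  have h2 : (d : ℂ) ≠ 0 := Nat.cast_ne_zero.2 hd.ne'
  rw [← had]
  push_cast
  field_simp
  ring

theorem discriminant_ofComplex_add_intCast (w : ℍ) (b : ℤ) :
    ModularForm.discriminant (ofComplex ((w : ℂ) + b)) = ModularForm.discriminant w := by
  have him : 0 < ((w : ℂ) + b).im := by simpa using w.im_pos
  rw [← cuspFunction_discriminant_qParam, ← cuspFunction_discriminant_qParam,
    ofComplex_apply_of_im_pos him]
  congr 1
  simp only [Function.Periodic.qParam]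
  rw [mul_add, add_div, Complex.exp_add, mul_comm _ (b : ℂ)]
  simp [Complex.exp_int_mul_two_pi_mul_I]

theorem analyticAt_deltaQuotient {N : ℕ} (hN : N ≠ 0) (z : ℍ) :
    AnalyticAt ℂ (fun w ↦ deltaQuotient N (ofComplex w)) (z : ℂ) := by
  have h1 : AnalyticAt ℂ (fun w : ℂ ↦ ModularForm.discriminant (ofComplex ((N : ℂ) * w))) z := by
    refine AnalyticAt.fun_comp (g := fun w ↦ ModularForm.discriminant (ofComplex w))
      (f := fun w : ℂ ↦ (N : ℂ) * w) ?_ (by fun_prop)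
    rw [← coe_ofComplex_natCast_mul (Nat.pos_of_ne_zero hN) z]
    exact analyticAt_discriminant _
  refine (h1.div (analyticAt_discriminant z) (ModularForm.discriminant_ne_zero _)).congr ?_
  filter_upwards [isOpen_upperHalfPlaneSet.mem_nhds z.im_pos] with w hw
  simp only [deltaQuotient, Pi.div_apply, ofComplex_apply_of_im_pos hw]

theorem isModularFunction_deltaQuotient {N : ℕ} (hN : N ≠ 0) :
    IsModularFunction N (deltaQuotient N) where
  meromorphic z := (analyticAt_deltaQuotient hN z).meromorphicAt
  invariant γ hγ z := by
    obtain ⟨a, d, b, ha, hd, had, haN, h⟩ := exists_deltaQuotient_smul_eq hN γ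
    obtain rfl := haN.2 hγ
    obtain rfl : d = 1 := by nlinarith
    have := discriminant_ofComplex_add_intCast (ofComplex ((a : ℂ) * (z : ℂ))) b
    rw [coe_ofComplex_natCast_mul ha] at this
    rw [h, Nat.cast_one, div_one, this, one_pow, one_mul, deltaQuotient]
  cusps γ := by
    obtain ⟨a, d, b, ha, hd, had, -, h⟩ := exists_deltaQuotient_smul_eq hN γ
    have key : ∀ (c : ℂ) (m : ℕ), m ≠ 0 →
        AnalyticAt ℂ (fun x : ℂ ↦ cuspFunction 1 ModularForm.discriminant (c * x ^ m)) 0 :=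
      fun c m hm ↦ AnalyticAt.fun_comp (g := cuspFunction 1 ModularForm.discriminant)
        (f := fun x : ℂ ↦ c * x ^ m)
        (by simpa [hm] using analyticAt_cuspFunction_discriminant) (by fun_prop)
    refine ⟨fun x ↦ cuspFunction 1 ModularForm.discriminant
        (Complex.exp (2 * Real.pi * Complex.I * (b / d)) * x ^ (a * a)) /
      ((d : ℂ) ^ 12 * cuspFunction 1 ModularForm.discriminant (1 * x ^ N)),
      (key _ _ (by positivity)).meromorphicAt.div
        ((MeromorphicAt.const _ _).mul (key _ _ hN).meromorphicAt), .of_forall fun z ↦ ?_⟩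
    beta_reduce
    rw [h, one_mul, ← qParam_one_eq_pow hN, ← qParam_one_affine b hd ha had,
      cuspFunction_discriminant_qParam, ← cuspFunction_discriminant_qParam (ofComplex _),
      ofComplex_apply_of_im_pos (im_affine_pos b ha hd z)]

open Asymptotics in
/-- `Δ(Nz)` decays faster at `∞` than `Δ((az + b) / d)` if `ad = N` and `a < N`, whence the
conjugates of `Δ(Nz) / Δ(z)` under elements outside `Γ₀(N)` differ from it. -/
theorem eventually_deltaQuotient_smul_ne {N : ℕ} (hN : N ≠ 0) {γ : SL(2, ℤ)}
    (hγ : γ ∉ CongruenceSubgroup.Gamma0 N) :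
    ∀ᶠ z : ℍ in atImInfty, deltaQuotient N (γ • z) ≠ deltaQuotient N z := by
  obtain ⟨a, d, b, ha, hd, had, haN, h⟩ := exists_deltaQuotient_smul_eq hN γ
  have hN0 : 0 < N := Nat.pos_of_ne_zero hN
  have hlt : a < N := lt_of_le_of_ne (Nat.le_of_dvd hN0 (had ▸ dvd_mul_right a d))
    fun h ↦ hγ (haN.1 h)
  have him : Tendsto (fun z : ℍ ↦ z.im) atImInfty atTop := tendsto_comap
  have him1 : ∀ z : ℍ, (ofComplex ((N : ℂ) * (z : ℂ)) : ℍ).im = N * z.im := fun z ↦ by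
    rw [← coe_im, coe_ofComplex_natCast_mul hN0]
    simp
  have him2 : ∀ z : ℍ, (ofComplex (((a : ℂ) * z + b) / d) : ℍ).im = a / d * z.im := fun z ↦ by
    rw [ofComplex_apply_of_im_pos (im_affine_pos b ha hd z), ← coe_im, coe_mk,
      Complex.div_natCast_im]
    simp
    ring
  have hd0 : (0 : ℝ) < d := Nat.cast_pos.2 hd
  have ha0 : (0 : ℝ) < a := Nat.cast_pos.2 ha
  have ht1 : Tendsto (fun z : ℍ ↦ (ofComplex ((N : ℂ) * (z : ℂ)) : ℍ)) atImInfty atImInfty := by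
    refine tendsto_comap_iff.2 ?_
    simp only [Function.comp_def, him1]
    exact him.const_mul_atTop (Nat.cast_pos.2 hN0)
  have ht2 : Tendsto (fun z : ℍ ↦ (ofComplex (((a : ℂ) * z + b) / d) : ℍ)) atImInfty
      atImInfty := by
    refine tendsto_comap_iff.2 ?_
    simp only [Function.comp_def, him2]
    exact him.const_mul_atTop (by positivity)
  have h1 := discriminant_isBigO_exp.comp_tendsto ht1
  have h2 := ModularForm.exp_isBigO_discriminant.comp_tendsto ht2
  simp only [Function.comp_def, him1, him2] at h1 h2
  have h3 : (fun z : ℍ ↦ Real.exp (-2 * Real.pi * (N * z.im))) =o[atImInfty]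
      fun z : ℍ ↦ Real.exp (-2 * Real.pi * (a / d * z.im)) := by
    rw [Real.isLittleO_exp_comp_exp_comp]
    have hc : 0 < 2 * Real.pi * (N - a / d) := by
      have : (a / d : ℝ) ≤ a := div_le_self ha0.le (by exact_mod_cast hd)
      have : (a : ℝ) < N := by exact_mod_cast hlt
      have := Real.pi_pos
      have : (0 : ℝ) < N - a / d := by linarith
      positivity
    refine (him.const_mul_atTop hc).congr fun z ↦ ?_
    ring
  have h4 := ((h1.trans_isLittleO h3).trans_isBigO h2).const_mul_left ((d : ℂ) ^ 12)
  filter_upwards [h4.def (c := 1 / 2) (by norm_num)] with z hz heq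
  have hΔ := ModularForm.discriminant_ne_zero z
  have hdc : (d : ℂ) ≠ 0 := Nat.cast_ne_zero.2 hd.ne'
  rw [h, deltaQuotient, div_eq_div_iff (by positivity) hΔ] at heq
  have heq' : (d : ℂ) ^ 12 * ModularForm.discriminant (ofComplex ((N : ℂ) * (z : ℂ))) =
      ModularForm.discriminant (ofComplex (((a : ℂ) * z + b) / d)) := by
    apply mul_right_cancel₀ hΔ
    rw [heq]
    ring
  rw [heq'] at hz
  have := norm_pos_iff.2
    (ModularForm.discriminant_ne_zero (ofComplex (((a : ℂ) * z + b) / d)))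
  linarith

/-! ### Functions on `ℍ` meromorphic at the cusps, and their conjugates -/

/-- The `ℂ`-algebra of meromorphic functions on `ℍ` which are meromorphic at every cusp, with no
condition of invariance. It contains the `SL₂(ℤ)`-conjugates of the elements of
`modularFunctions N`. -/
def cuspMeromorphicFunctions (N : ℕ) : Subalgebra ℂ (ℍ → ℂ) where
  carrier := {f | (∀ z : ℍ, MeromorphicAt (fun w : ℂ ↦ f (ofComplex w)) (z : ℂ)) ∧
    ∀ γ : SL(2, ℤ), ∃ g : ℂ → ℂ, MeromorphicAt g 0 ∧
      ∀ᶠ z : ℍ in atImInfty, f (γ • z) = g (Function.Periodic.qParam (N : ℝ) (z : ℂ))}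
  mul_mem' := fun {f g} hf hg ↦ ⟨fun z ↦ (hf.1 z).mul (hg.1 z), fun γ ↦ by
    obtain ⟨F, hF, hF'⟩ := hf.2 γ
    obtain ⟨G, hG, hG'⟩ := hg.2 γ
    refine ⟨F * G, hF.mul hG, ?_⟩
    filter_upwards [hF', hG'] with z h1 h2
    simp only [Pi.mul_apply, h1, h2]⟩
  add_mem' := fun {f g} hf hg ↦ ⟨fun z ↦ (hf.1 z).add (hg.1 z), fun γ ↦ by
    obtain ⟨F, hF, hF'⟩ := hf.2 γ
    obtain ⟨G, hG, hG'⟩ := hg.2 γ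
    refine ⟨F + G, hF.add hG, ?_⟩
    filter_upwards [hF', hG'] with z h1 h2
    simp only [Pi.add_apply, h1, h2]⟩
  algebraMap_mem' c := ⟨fun _ ↦ MeromorphicAt.const c _, fun _ ↦
    ⟨fun _ ↦ c, MeromorphicAt.const c _, .of_forall fun _ ↦ rfl⟩⟩

variable {N : ℕ}

theorem meromorphicAt_comp_smul {f : ℍ → ℂ} (γ : SL(2, ℤ)) (z : ℍ)
    (hf : MeromorphicAt (fun w : ℂ ↦ f (ofComplex w)) ((γ • z : ℍ) : ℂ)) :
    MeromorphicAt (fun w : ℂ ↦ f (γ • ofComplex w)) (z : ℂ) := by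
  have hdet : 0 < (Matrix.SpecialLinearGroup.mapGL ℝ γ).det.val := by simp
  have h := MeromorphicAt.comp_analyticAt (f := fun w : ℂ ↦ f (ofComplex w))
    (g := fun w : ℂ ↦ ((γ • ofComplex w : ℍ) : ℂ)) (x := (z : ℂ)) (by simpa using hf)
    (z.analyticAt_smul hdet)
  simpa [Function.comp_def] using h

/-- Precomposition with the action of `γ ∈ SL₂(ℤ)`. -/
noncomputable def compSmul (γ : SL(2, ℤ)) : cuspMeromorphicFunctions N →+* cuspMeromorphicFunctions N where
  toFun f := ⟨fun z ↦ (f : ℍ → ℂ) (γ • z), fun z ↦ meromorphicAt_comp_smul γ z (f.2.1 (γ • z)),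
    fun δ ↦ by simpa only [mul_smul] using f.2.2 (γ * δ)⟩
  map_one' := rfl
  map_mul' _ _ := rfl
  map_zero' := rfl
  map_add' _ _ := rfl

theorem compSmul_apply (γ : SL(2, ℤ)) (f : cuspMeromorphicFunctions N) (z : ℍ) :
    (compSmul γ f : ℍ → ℂ) z = (f : ℍ → ℂ) (γ • z) := rfl

theorem compSmul_compSmul (γ δ : SL(2, ℤ)) (f : cuspMeromorphicFunctions N) :
    compSmul γ (compSmul δ f) = compSmul (δ * γ) f := by
  ext z
  simp only [compSmul_apply, mul_smul]

theorem IsModularFunction.mem_cuspMeromorphicFunctions {f : ℍ → ℂ}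
    (hf : IsModularFunction N f) : f ∈ cuspMeromorphicFunctions N :=
  ⟨hf.meromorphic, hf.cusps⟩

theorem isModularFunction_iff_compSmul {f : cuspMeromorphicFunctions N} :
    IsModularFunction N f ↔ ∀ γ ∈ CongruenceSubgroup.Gamma0 N, compSmul γ f = f :=
  ⟨fun h γ hγ ↦ Subtype.ext (funext (h.invariant γ hγ)), fun h ↦
    ⟨f.2.1, fun γ hγ ↦ congrFun (congrArg Subtype.val (h γ hγ)), f.2.2⟩⟩

/-- The conjugate of a `Γ₀(N)`-invariant function `f` indexed by the left coset `g Γ₀(N)`, namely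
`z ↦ f (g⁻¹ z)`. -/
noncomputable def conjugate (f : cuspMeromorphicFunctions N)
    (x : SL(2, ℤ) ⧸ CongruenceSubgroup.Gamma0 N) : cuspMeromorphicFunctions N :=
  compSmul x.out⁻¹ f

theorem conjugate_mk {f : cuspMeromorphicFunctions N} (hf : IsModularFunction N f)
    (g : SL(2, ℤ)) : conjugate f (QuotientGroup.mk g) = compSmul g⁻¹ f := by
  obtain ⟨h, hh⟩ := QuotientGroup.mk_out_eq_mul (CongruenceSubgroup.Gamma0 N) g
  rw [conjugate, hh, mul_inv_rev, ← compSmul_compSmul,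
    isModularFunction_iff_compSmul.1 hf _ (inv_mem h.2)]

theorem compSmul_conjugate {f : cuspMeromorphicFunctions N} (hf : IsModularFunction N f)
    (γ : SL(2, ℤ)) (x : SL(2, ℤ) ⧸ CongruenceSubgroup.Gamma0 N) :
    compSmul γ (conjugate f x) = conjugate f (γ⁻¹ • x) := by
  induction x using QuotientGroup.induction_on with
  | H g =>
    rw [MulAction.Quotient.smul_coe, smul_eq_mul, conjugate_mk hf, conjugate_mk hf,
      compSmul_compSmul, mul_inv_rev, inv_inv]

/-! ### Interpolation over the conjugates -/

open Polynomial in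
open scoped Classical in
/-- The Lagrange interpolation numerator `∑ₓ hₓ ∏_{y ≠ x} (X - f_y)`, where `fₓ` and `hₓ` are the
conjugates of `f` and `h`. -/
noncomputable def lagrangeNumerator [Fintype (SL(2, ℤ) ⧸ CongruenceSubgroup.Gamma0 N)]
    (f h : cuspMeromorphicFunctions N) : (cuspMeromorphicFunctions N)[X] :=
  ∑ x : SL(2, ℤ) ⧸ CongruenceSubgroup.Gamma0 N,
    C (conjugate h x) * ∏ y ∈ Finset.univ.erase x, (X - C (conjugate f y))

open scoped Classical in
/-- The action of `γ` permutes the conjugates, so it fixes the coefficients of the interpolation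
numerator. -/
theorem map_compSmul_lagrangeNumerator
    [Fintype (SL(2, ℤ) ⧸ CongruenceSubgroup.Gamma0 N)] {f h : cuspMeromorphicFunctions N}
    (hf : IsModularFunction N f) (hh : IsModularFunction N h) (γ : SL(2, ℤ)) :
    (lagrangeNumerator f h).map (compSmul γ) = lagrangeNumerator f h := by
  rw [lagrangeNumerator, Polynomial.map_sum]
  refine Fintype.sum_equiv (MulAction.toPerm γ⁻¹) _ _ fun x ↦ ?_
  rw [Polynomial.map_mul, Polynomial.map_prod, Polynomial.map_C, compSmul_conjugate hh]
  congr 1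
  refine Finset.prod_equiv (MulAction.toPerm γ⁻¹) (fun y ↦ by simp) fun y _ ↦ ?_
  rw [Polynomial.map_sub, Polynomial.map_X, Polynomial.map_C, compSmul_conjugate hf]
  rfl

open scoped Classical in
/-- At `f = f₁` all terms but that of the trivial coset contain the factor `f - f₁ = 0`. -/
theorem eval_lagrangeNumerator
    [Fintype (SL(2, ℤ) ⧸ CongruenceSubgroup.Gamma0 N)] {f h : cuspMeromorphicFunctions N}
    (hf : IsModularFunction N f) (hh : IsModularFunction N h) :
    (lagrangeNumerator f h).eval f = h * ∏ y ∈ Finset.univ.erase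
      (QuotientGroup.mk 1 : SL(2, ℤ) ⧸ CongruenceSubgroup.Gamma0 N), (f - conjugate f y) := by
  have h1 : ∀ {u : cuspMeromorphicFunctions N}, IsModularFunction N u →
      conjugate u (QuotientGroup.mk 1) = u := fun {u} hu ↦ by
    rw [conjugate_mk hu, inv_one]
    ext z
    simp [compSmul_apply]
  rw [lagrangeNumerator, Polynomial.eval_finsetSum,
    Finset.sum_eq_single_of_mem (QuotientGroup.mk 1) (Finset.mem_univ _)]
  · simp [Polynomial.eval_prod, h1 hh]
  · intro x _ hx
    rw [Polynomial.eval_mul, Polynomial.eval_prod,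
      Finset.prod_eq_zero (Finset.mem_erase.2 ⟨hx.symm, Finset.mem_univ _⟩), mul_zero]
    simp [h1 hf]

/-! ### The function field -/

theorem toField_eq_iff {f g : ℍ → ℂ} (hf : IsModularFunction N f) (hg : IsModularFunction N g) :
    hf.toField = hg.toField ↔ ∀ z : ℍ, f =ᶠ[𝓝[≠] z] g := by
  rw [IsModularFunction.toField, IsModularFunction.toField, Ideal.Quotient.eq,
    mem_negligible_iff]
  refine forall_congr' fun z ↦ ?_
  rw [eventually_nhdsNE_coe_iff (P := fun w ↦ ((⟨f, hf⟩ - ⟨g, hg⟩ : modularFunctions N) :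
    ℍ → ℂ) w = 0)]
  simp [sub_eq_zero, EventuallyEq]

/-- A modular function without zeros high up in `ℍ` is nonzero in the function field. -/
theorem toField_ne_zero {f : ℍ → ℂ} (hf : IsModularFunction N f)
    (h : ∀ᶠ z in atImInfty, f z ≠ 0) : hf.toField ≠ 0 := by
  intro h0
  have h1 := (toField_eq_iff hf (IsModularFunction.const N 0)).1 h0
  obtain ⟨A, hA⟩ := (atImInfty_mem _).1 h
  let z : ℍ := ⟨⟨0, max A 0 + 1⟩, by positivity⟩
  have hz : A < z.im := lt_of_le_of_lt (le_max_left A 0) (lt_add_one _)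
  have h2 : ∀ᶠ w : ℍ in 𝓝[≠] z, A < w.im := nhdsWithin_le_nhds
    ((isOpen_lt continuous_const continuous_im).mem_nhds hz)
  obtain ⟨w, hw1, hw2⟩ := ((h1 z).and h2).exists
  exact hA w hw2.le hw1

theorem aeval_toField_modularJ (hN : N ≠ 0) (p : Polynomial ℂ) :
    Polynomial.aeval (isModularFunction_modularJ hN).toField p =
      (IsModularFunction.eval_modularJ hN p).toField := by
  let J : modularFunctions N := ⟨modularJ, isModularFunction_modularJ hN⟩
  have h1 : Polynomial.aeval (isModularFunction_modularJ hN).toField p =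
      Ideal.Quotient.mkₐ ℂ (negligible N) (Polynomial.aeval J p) :=
    Polynomial.aeval_algHom_apply (Ideal.Quotient.mkₐ ℂ (negligible N)) J p
  have h2 : Polynomial.aeval J p = ⟨_, IsModularFunction.eval_modularJ hN p⟩ := by
    ext z
    have := Polynomial.aeval_algHom_apply
      ((Pi.evalAlgHom ℂ (fun _ : ℍ ↦ ℂ) z).comp (modularFunctions N).val) J p
    exact this.symm.trans (congrFun (Polynomial.coe_aeval_eq_eval _) p)
  rw [h1, h2]
  rfl

theorem eventually_eval_modularJ_ne_zero {p : Polynomial ℂ} (hp : p ≠ 0) :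
    ∀ᶠ z in atImInfty, p.eval (modularJ z) ≠ 0 := by
  have h : ∀ᶠ z in atImInfty, ∀ a ∈ p.roots.toFinset, modularJ z ≠ a := by
    rw [Finset.eventually_all]
    intro a _
    filter_upwards [tendsto_norm_modularJ_atImInfty.eventually_gt_atTop ‖a‖] with z hz h
    rw [h] at hz
    exact lt_irrefl _ hz
  filter_upwards [h] with z hz h0
  exact hz _ (by simpa [hp] using h0) rfl

/-- `ℂ(j)` contains the classes of the `SL₂(ℤ)`-invariant modular functions. -/
theorem toField_mem_of_invariant (hN : N ≠ 0) {F : IntermediateField ℂ (X0FunctionField N)}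
    (hF : (isModularFunction_modularJ hN).toField ∈ F) {f : ℍ → ℂ} (hf : IsModularFunction N f)
    (hinv : ∀ (γ : SL(2, ℤ)) (z : ℍ), f (γ • z) = f z) : hf.toField ∈ F := by
  obtain ⟨p, r, hr, h⟩ := exists_polynomial_mul_eventuallyEq hN hf hinv
  have hmem : ∀ q : Polynomial ℂ, (IsModularFunction.eval_modularJ hN q).toField ∈ F := fun q ↦ by
    rw [← aeval_toField_modularJ hN, Polynomial.aeval_eq_sum_range]
    exact sum_mem fun i _ ↦ F.smul_mem (pow_mem hF i)
  have hr0 := toField_ne_zero (IsModularFunction.eval_modularJ hN r)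
    (eventually_eval_modularJ_ne_zero hr)
  have heq : (IsModularFunction.eval_modularJ hN r).toField * hf.toField =
      (IsModularFunction.eval_modularJ hN p).toField :=
    (toField_eq_iff ((IsModularFunction.eval_modularJ hN r).mul hf) _).2 h
  rw [eq_div_of_mul_eq hr0 ((mul_comm _ _).trans heq)]
  exact div_mem (hmem p) (hmem r)

/-- If the coefficients of a polynomial are `SL₂(ℤ)`-invariant, its value at `f` is a polynomial in
`f` whose coefficients are rational functions of `j`. -/
theorem exists_toField_eval_mem (hN : N ≠ 0) {F : IntermediateField ℂ (X0FunctionField N)}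
    (hF : (isModularFunction_modularJ hN).toField ∈ F) {f : cuspMeromorphicFunctions N}
    (hf : IsModularFunction N f) (hfF : hf.toField ∈ F)
    {P : Polynomial (cuspMeromorphicFunctions N)} (hP : ∀ γ, P.map (compSmul γ) = P) :
    ∃ h : IsModularFunction N (P.eval f : cuspMeromorphicFunctions N), h.toField ∈ F := by
  let p : cuspMeromorphicFunctions N → Prop := fun u ↦
    ∃ h : IsModularFunction N u, h.toField ∈ F
  have hmul : ∀ u v, p u → p v → p (u * v) := fun u v ⟨hu, hu'⟩ ⟨hv, hv'⟩ ↦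
    ⟨hu.mul hv, mul_mem hu' hv'⟩
  have hone : p 1 := ⟨.const N 1, one_mem F⟩
  have hpow : ∀ i : ℕ, p (f ^ i) := fun i ↦ by
    induction i with
    | zero => rw [pow_zero]; exact hone
    | succ i ih => rw [pow_succ]; exact hmul _ _ ih ⟨hf, hfF⟩
  change p (P.eval f)
  rw [Polynomial.eval_eq_sum_range]
  refine Finset.sum_induction _ p (fun u v ⟨hu, hu'⟩ ⟨hv, hv'⟩ ↦ ⟨hu.add hv, add_mem hu' hv'⟩)
    ⟨.const N 0, zero_mem F⟩ fun i _ ↦ hmul _ _ ?_ (hpow i)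
  have h : ∀ γ, compSmul γ (P.coeff i) = P.coeff i := fun γ ↦ by
    rw [← Polynomial.coeff_map, hP]
  exact ⟨isModularFunction_iff_compSmul.2 fun γ _ ↦ h γ, toField_mem_of_invariant hN hF _
    fun γ z ↦ congrFun (congrArg Subtype.val (h γ)) z⟩

end ModularCurve

open ModularCurve in
theorem mainTheorem2 (N : ℕ) (hN : 2 ≤ N) :
    ∃ (hj : ModularCurve.IsModularFunction N ModularCurve.modularJ)
      (hΔ : ModularCurve.IsModularFunction N (ModularCurve.deltaQuotient N)),
      IntermediateField.adjoin ℂ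
        ({hj.toField, hΔ.toField} : Set (ModularCurve.X0FunctionField N)) = ⊤ := by
  classical
  have hN0 : N ≠ 0 := by lia
  have : NeZero N := ⟨hN0⟩
  let _ : Fintype (SL(2, ℤ) ⧸ CongruenceSubgroup.Gamma0 N) := Subgroup.fintypeQuotientOfFiniteIndex
  refine ⟨isModularFunction_modularJ hN0, isModularFunction_deltaQuotient hN0, ?_⟩
  set F := IntermediateField.adjoin ℂ ({(isModularFunction_modularJ hN0).toField,
    (isModularFunction_deltaQuotient hN0).toField} : Set (X0FunctionField N))
  have hjF : (isModularFunction_modularJ hN0).toField ∈ F :=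
    IntermediateField.subset_adjoin _ _ (by simp)
  rw [eq_top_iff]
  intro u _
  obtain ⟨⟨h, hh⟩, rfl⟩ := Ideal.Quotient.mk_surjective u
  let f' : cuspMeromorphicFunctions N :=
    ⟨deltaQuotient N, (isModularFunction_deltaQuotient hN0).mem_cuspMeromorphicFunctions⟩
  let h' : cuspMeromorphicFunctions N := ⟨h, hh.mem_cuspMeromorphicFunctions⟩
  have hf' : IsModularFunction N f' := isModularFunction_deltaQuotient hN0
  have hh' : IsModularFunction N h' := hh
  have hone : IsModularFunction N (1 : cuspMeromorphicFunctions N) := .const N 1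
  have hfF : hf'.toField ∈ F := IntermediateField.subset_adjoin _ _ (by
    exact Set.mem_insert_of_mem _ rfl)
  -- `k1` represents `Q_1(f) = ∏ (f - f_y)` and `k2` represents `Q_h(f)`
  obtain ⟨k1, hk1⟩ := exists_toField_eval_mem hN0 hjF hf' hfF
    (map_compSmul_lagrangeNumerator hf' hone)
  obtain ⟨k2, hk2⟩ := exists_toField_eval_mem hN0 hjF hf' hfF
    (map_compSmul_lagrangeNumerator hf' hh')
  have hmul : hh'.toField * k1.toField = k2.toField := by
    refine (toField_eq_iff (hh'.mul k1) k2).2 fun z ↦ .of_eq ?_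
    rw [← MulMemClass.coe_mul, eval_lagrangeNumerator hf' hone, eval_lagrangeNumerator hf' hh',
      one_mul]
  have hne : k1.toField ≠ 0 := by
    -- each factor `f - f_y` is nonzero high up in `ℍ`
    refine toField_ne_zero k1 ?_
    have hfac : ∀ᶠ z in atImInfty, ∀ y ∈ Finset.univ.erase
        (QuotientGroup.mk 1 : SL(2, ℤ) ⧸ CongruenceSubgroup.Gamma0 N),
        ((f' - conjugate f' y : cuspMeromorphicFunctions N) : ℍ → ℂ) z ≠ 0 := by
      rw [Finset.eventually_all]
      intro y hy
      induction y using QuotientGroup.induction_on with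
      | H g =>
        have hg : g⁻¹ ∉ CongruenceSubgroup.Gamma0 N := fun hg ↦
          (Finset.mem_erase.1 hy).1 (QuotientGroup.eq.2 (by simpa using hg))
        filter_upwards [eventually_deltaQuotient_smul_ne hN0 hg] with z hz
        rw [conjugate_mk hf']
        exact sub_ne_zero.2 hz.symm
    filter_upwards [hfac] with z hz
    rw [eval_lagrangeNumerator hf' hone, one_mul]
    have : ((∏ y ∈ Finset.univ.erase (QuotientGroup.mk 1 : SL(2, ℤ) ⧸
        CongruenceSubgroup.Gamma0 N), (f' - conjugate f' y) : cuspMeromorphicFunctions N) :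
        ℍ → ℂ) z = ∏ y ∈ Finset.univ.erase (QuotientGroup.mk 1),
          ((f' - conjugate f' y : cuspMeromorphicFunctions N) : ℍ → ℂ) z := by
      rw [SubmonoidClass.coe_finsetProd, Finset.prod_apply]
    rw [this]
    exact Finset.prod_ne_zero_iff.2 hz
  change hh'.toField ∈ F
  rw [eq_div_of_mul_eq hne hmul]
  exact div_mem hk2 hk1
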